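/- Let $Q \subset M$ be a finite-index subfactor of a $\mathrm{II}_1$ factor $M$, with Jones index $[M:Q]=\dim_Q L^2(M)$. For a planar tangle $T$ (an external disc of colour $k_0$, internal discs $D_1,\dots,D_b$ of colours $k_1,\dots,k_b$, $b \ge 0$, where a disc of colour $k\in\{0_+,0_-,1,2,\dots\}$ has $2k$ marked points on its boundary (none for $0_\pm$), together with disjoint strings and a checkerboard shading), let $l(T)$ be the number of closed loops obtained after capping the black boundary intervals of the external disc of $T$ (joining the two end points of each such interval) and cupping the black boundary intervals of all internal discs of $T$, and put \[ c(T)=\bigl(\lceil k_0/2\rceil+\lfloor k_1/2\rfloor+\dots+\lfloor k_b/2\rfloor\bigr)-l(T),\qquad \alpha(T)=[M:Q]^{\frac12 c(T)}. \] Let $T=T^{k_0}_{k_1,\dots,k_b}$ and $\tilde T=\tilde T^{\tilde k_0}_{\tilde k_1,\dots,\tilde k_{\tilde b}}$ be planar tangles with discs of the indicated colours such that $\tilde k_0=k_i$ for some $1\le i\le b$, and let $T\circ_i\tilde T$ be the tangle obtained by inserting $\tilde T$ into the $i$-th internal disc of $T$. Then \[ \frac{\alpha(T)\,\alpha(\tilde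 T)}{\alpha(T\circ_i\tilde T)}=[M:Q]^{\frac12\left(\tilde k_0-l(T)-l(\tilde T)+l(T\circ_i\tilde T)\right)}. \] (In arithmetic expressions the colours $0_\pm$ count as $0$.) -/

import Mathlib

open scoped ENNReal InnerProductSpace

noncomputable section

namespace IntermediatePlanar

universe u

/-! ## II₁ factors and the Jones index -/

section Index

variable {H : Type u} [NormedAddCommGroup H] [InnerProductSpace ℂ H] [CompleteSpace H]

/-- `τ` restricts to a faithful normal tracial state on the von Neumann algebra `A`
(its values outside `A` play no role). Normality is expressed by writing `τ` as a sum of vector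
functionals `x ↦ ⟨ξₙ, x ξₙ⟩` with `∑ ‖ξₙ‖² < ∞`; this includes linearity and positivity on `A`. -/
structure IsFaithfulNormalTrace (A : VonNeumannAlgebra H) (τ : (H →L[ℂ] H) → ℂ) : Prop where
  map_one : τ 1 = 1
  normal : ∃ ξ : ℕ → H, (Summable fun n => ‖ξ n‖ ^ 2) ∧
    ∀ x ∈ A, HasSum (fun n => ⟪ξ n, x (ξ n)⟫_ℂ) (τ x)
  tracial : ∀ x ∈ A, ∀ y ∈ A, τ (x * y) = τ (y * x)
  faithful : ∀ x ∈ A, τ (star x * x) = 0 → x = 0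

/-- The algebra carries a faithful normal tracial state. For a factor this means that it is
finite, and the tracial state is then unique. -/
def HasTrace (A : VonNeumannAlgebra H) : Prop :=
  ∃ τ : (H →L[ℂ] H) → ℂ, IsFaithfulNormalTrace A τ

open Classical in
/-- The normalized trace `tr_A` of a finite factor `A` (and `0` if there is no trace). -/
def normalizedTrace (A : VonNeumannAlgebra H) : (H →L[ℂ] H) → ℂ :=
  if h : HasTrace A then h.choose else 0

/-- `A` is a factor: its centre consists of the scalars. -/
def IsFactor (A : VonNeumannAlgebra H) : Prop :=
  ∀ x ∈ A, x ∈ A.commutant → ∃ c : ℂ, x = c • (1 : H →L[ℂ] H)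

/-- `A` is a factor of type II₁: an infinite-dimensional factor with a faithful normal
tracial state. -/
structure IsTypeIIOneFactor (A : VonNeumannAlgebra H) : Prop where
  factor : IsFactor A
  infinite : ¬ FiniteDimensional ℂ A.toStarSubalgebra
  hasTrace : HasTrace A

/-- The closed subspace `closure (A ξ)`. -/
def cyclicSubspace (A : VonNeumannAlgebra H) (ξ : H) : Submodule ℂ H :=
  (Submodule.span ℂ {η : H | ∃ x ∈ A, η = x ξ}).topologicalClosure

/-- The orthogonal projection of `H` onto `closure (A ξ)`; it lies in the commutant of `A`. -/
def cyclicProjection (A : VonNeumannAlgebra H) (ξ : H) : H →L[ℂ] H :=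
  haveI : CompleteSpace (cyclicSubspace A ξ) :=
    (Submodule.isClosed_topologicalClosure _).completeSpace_coe
  (cyclicSubspace A ξ).starProjection

open Classical in
/-- The Murray-von Neumann coupling constant `dim_A H` of a II₁ factor `A` acting on `H`,
computed at a nonzero vector `ξ` (on which it does not depend):
`tr_A [A' ξ] / tr_{A'} [A ξ]` if the commutant `A'` is finite, and `∞` otherwise. -/
def couplingConstant (A : VonNeumannAlgebra H) (ξ : H) : ℝ≥0∞ :=
  if HasTrace A.commutant then
    ENNReal.ofReal ((normalizedTrace A (cyclicProjection A.commutant ξ)).re /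
      (normalizedTrace A.commutant (cyclicProjection A ξ)).re)
  else ⊤

/-- `Ω` is a cyclic unit vector for `M` whose vector state is a trace on `M`. This says exactly
that `(H, Ω)` is, up to unitary equivalence, the GNS space `L²(M)` of the trace of `M` together
with its canonical vector. -/
structure IsTraceVector (M : VonNeumannAlgebra H) (Ω : H) : Prop where
  norm_eq_one : ‖Ω‖ = 1
  cyclic : cyclicSubspace M Ω = ⊤
  tracial : ∀ x ∈ M, ∀ y ∈ M, ⟪Ω, (x * y) Ω⟫_ℂ = ⟪Ω, (y * x) Ω⟫_ℂ

/-- The Jones index `[M : Q] = dim_Q L²(M)` of a subfactor `Q` of a II₁ factor `M`, where `M` acts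
on `H = L²(M)` with canonical trace vector `Ω`. -/
def jonesIndex (Q : VonNeumannAlgebra H) (Ω : H) : ℝ≥0∞ :=
  couplingConstant Q Ω

end Index

/-! ## Planar tangles -/

/-- The colours `0₊, 0₋, 1, 2, 3, …`. -/
inductive Colour where
  | zeroPlus : Colour
  | zeroMinus : Colour
  | pos : ℕ+ → Colour

/-- The number `k` belonging to a colour; a disc of this colour has `2 k` marked points. -/
def Colour.size : Colour → ℕ
  | .zeroPlus => 0
  | .zeroMinus => 0
  | .pos k => k

/-- `f` is ambient isotopic to the identity of the plane (equivalently, it preserves the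
orientation). -/
def IsIsotopicToId (f : ℂ ≃ₜ ℂ) : Prop :=
  ∃ F : unitInterval × ℂ → ℂ, Continuous F ∧
    (∀ t, ∃ h : ℂ ≃ₜ ℂ, ∀ z, F (t, z) = h z) ∧
    (∀ z, F (0, z) = z) ∧ (∀ z, F (1, z) = f z)

/-- The point of the unit circle reached from `1` after `θ` clockwise turns. -/
def clockwise (θ : ℝ) : ℂ := Complex.exp (-(2 * Real.pi * θ : ℝ) * Complex.I)

/-- The `m`-th of the `2 k` standard marked points on the unit circle (`m = 0, …, 2 k - 1`),
numbered clockwise, with the point `1` on the arc between the last and the first of them. -/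
def standardPoint (k m : ℕ) : ℂ := clockwise ((2 * m + 1) / (4 * k))

/-- The union of the `k` black intervals of the unit circle with its `2 k` standard marked points:
the closed arcs running clockwise from the point `2 i` to the point `2 i + 1`, `i < k`. -/
def standardBlackIntervals (k : ℕ) : Set ℂ :=
  {u | ∃ i < k, ∃ θ ∈ Set.Icc ((4 * i + 1 : ℝ) / (4 * k)) ((4 * i + 3) / (4 * k)),
    u = clockwise θ}

/-- A closed disc in the plane with a colour `k` and `2 k` marked points on its boundary which are
numbered clockwise, starting from a distinguished boundary arc `*`. It is given by a homeomorphism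
of the plane that maps the standard disc, with the point `1` on its `*`-arc, to it. -/
structure MarkedDisc where
  colour : Colour
  param : ℂ ≃ₜ ℂ
  isotopic : IsIsotopicToId param

namespace MarkedDisc

/-- The number `k` of the disc. -/
def size (D : MarkedDisc) : ℕ := D.colour.size

/-- The closed disc. -/
def carrier (D : MarkedDisc) : Set ℂ := D.param '' Metric.closedBall 0 1

/-- The open disc. -/
def inside (D : MarkedDisc) : Set ℂ := D.param '' Metric.ball 0 1

/-- The `m`-th marked point, `m < 2 k`. -/
def point (D : MarkedDisc) (m : ℕ) : ℂ := D.param (standardPoint D.size m)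

/-- The set of marked points. -/
def points (D : MarkedDisc) : Set ℂ := {z | ∃ m < 2 * D.size, z = D.point m}

/-- The union of the black intervals of the boundary (empty if there are no marked points). -/
def blackIntervals (D : MarkedDisc) : Set ℂ := D.param '' standardBlackIntervals D.size

/-- `f` carries `D` to `E`, respecting colours and the numbered marked points. -/
structure MapsTo (f : ℂ ≃ₜ ℂ) (D E : MarkedDisc) : Prop where
  colour_eq : E.colour = D.colour
  carrier_eq : E.carrier = f '' D.carrier
  point_eq : ∀ m < 2 * D.size, E.point m = f (D.point m)

end MarkedDisc

/-- `s` is a single string: either an embedded arc with both ends at marked points (the set `P`)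
and otherwise in the open set `U`, or an embedded circle in `U`. -/
def IsString (P U s : Set ℂ) : Prop :=
  (∃ γ : C(unitInterval, ℂ), Function.Injective γ ∧ Set.range γ = s ∧ γ 0 ∈ P ∧ γ 1 ∈ P ∧
      ∀ t, t ≠ 0 → t ≠ 1 → γ t ∈ U) ∨
    (∃ γ : C(Circle, ℂ), Function.Injective γ ∧ Set.range γ = s ∧ s ⊆ U)

/-- A planar tangle: an external marked disc, `b` internal marked discs, a finite system of
disjoint strings between marked points or closed (`strings` is their union) and a checkerboard
shading (`black` is the union of the black regions). On every boundary with marked points the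
arcs are alternately white and black, the `*`-arc being white; the boundary of a disc of
colour `0₊` is white and that of a disc of colour `0₋` is black. -/
structure Tangle where
  outer : MarkedDisc
  b : ℕ
  inner : Fin b → MarkedDisc
  strings : Set ℂ
  black : Set ℂ
  inner_subset : ∀ j, (inner j).carrier ⊆ outer.inside
  inner_disjoint : ∀ i j, i ≠ j → Disjoint (inner i).carrier (inner j).carrier
  strings_spec : ∃ (n : ℕ) (s : Fin n → Set ℂ),
    (∀ i j, i ≠ j → Disjoint (s i) (s j)) ∧ strings = ⋃ i, s i ∧
    ∀ i, IsString (outer.points ∪ ⋃ j, (inner j).points)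
      (outer.inside \ ⋃ j, (inner j).carrier) (s i)
  points_subset : outer.points ∪ ⋃ j, (inner j).points ⊆ strings
  black_subset : black ⊆ outer.carrier \ ((⋃ j, (inner j).inside) ∪ strings)
  /-- `black` is a union of connected regions of the complement of the strings. -/
  black_clopen : IsClopen
    (Subtype.val ⁻¹' black : Set ↥(outer.carrier \ ((⋃ j, (inner j).inside) ∪ strings)))
  /-- The two sides of each string have different colours. -/
  checkerboard : ∀ z ∈ strings, z ∈ closure black ∧
    z ∈ closure ((outer.carrier \ ((⋃ j, (inner j).inside) ∪ strings)) \ black)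
  boundary_shading : ∀ D : MarkedDisc, (D = outer ∨ ∃ j, D = inner j) →
    ∀ v ∈ Metric.sphere (0 : ℂ) 1, D.param v ∉ D.points →
      (D.param v ∈ black ↔ v ∈ standardBlackIntervals D.size ∨ D.colour = Colour.zeroMinus)

namespace Tangle

/-- The curves obtained from the strings of `T` by capping the black intervals of the external
disc and cupping the black intervals of all internal discs. The cap or cup that joins the two ends
of a black interval is drawn along this interval. -/
def capped (T : Tangle) : Set ℂ :=
  T.strings ∪ T.outer.blackIntervals ∪ ⋃ j, (T.inner j).blackIntervals

/-- `l(T)`: the number of closed loops after black capping and cupping. The capped curves are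
disjoint closed loops, so this is the number of connected components of their union. -/
def loops (T : Tangle) : ℕ := Nat.card (ConnectedComponents ↥T.capped)

/-- `c(T) = (⌈k₀/2⌉ + ⌊k₁/2⌋ + ⋯ + ⌊k_b/2⌋) - l(T)`. -/
def c (T : Tangle) : ℤ :=
  (⌈(T.outer.size : ℚ) / 2⌉ + ∑ j, ⌊((T.inner j).size : ℚ) / 2⌋) - T.loops

/-- `α(T) = [M : Q] ^ (c(T) / 2)`, where `M` acts on `L²(M)` with trace vector `Ω`. -/
def alpha {H : Type u} [NormedAddCommGroup H] [InnerProductSpace ℂ H] [CompleteSpace H]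
    (Q : VonNeumannAlgebra H) (Ω : H) (T : Tangle) : ℝ :=
  (jonesIndex Q Ω).toReal ^ ((1 / 2 : ℝ) * T.c)

/-- `S` represents the composite `T ∘ᵢ T'`: after isotopies `f` of `T` and `g` of `T'`, the external
disc of `T'` coincides with the `i`-th internal disc of `T`, with the same numbered marked points,
and `S` is obtained by inserting `T'` into this disc and erasing its boundary. The internal discs
of `S` are those of `T` other than the `i`-th one together with those of `T'`. -/
def IsComposition (T : Tangle) (i : Fin T.b) (T' S : Tangle) : Prop :=
  ∃ (f g : ℂ ≃ₜ ℂ) (e : {j : Fin T.b // j ≠ i} ⊕ Fin T'.b ≃ Fin S.b),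
    IsIsotopicToId f ∧ IsIsotopicToId g ∧
    f '' (T.inner i).carrier = g '' T'.outer.carrier ∧
    (∀ m < 2 * (T.inner i).size, f ((T.inner i).point m) = g (T'.outer.point m)) ∧
    MarkedDisc.MapsTo f T.outer S.outer ∧
    (∀ j, MarkedDisc.MapsTo f (T.inner j.1) (S.inner (e (Sum.inl j)))) ∧
    (∀ j, MarkedDisc.MapsTo g (T'.inner j) (S.inner (e (Sum.inr j)))) ∧
    S.strings = f '' T.strings ∪ g '' T'.strings ∧
    S.black = f '' T.black ∪ g '' T'.black

end Tangle

end IntermediatePlanar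

end

/-!
Powers of a positive number turn the claim into the additive identity
`c(T) + c(T') - c(S) = k - l(T) - l(T') + l(S)` for the composite `S` along a disc of colour `k`.
Gluing removes exactly two discs, the external disc of `T'`, which contributes `⌈k/2⌉`, and the
`i`-th internal disc of `T`, which contributes `⌊k/2⌋`; together they contribute `k`.

The index is positive because it is a quotient of traces of the projections onto the closures of
`Q' Ω` and `Q Ω`: these projections are nonzero, as `Ω` is, and the traces are faithful.
-/

namespace IntermediatePlanar

section Index

variable {H : Type*} [NormedAddCommGroup H] [InnerProductSpace ℂ H] [CompleteSpace H]

instance (A : VonNeumannAlgebra H) (ξ : H) : CompleteSpace (cyclicSubspace A ξ) :=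
  (Submodule.isClosed_topologicalClosure _).completeSpace_coe

theorem mem_cyclicSubspace_self (A : VonNeumannAlgebra H) (ξ : H) : ξ ∈ cyclicSubspace A ξ :=
  Submodule.le_topologicalClosure _ (Submodule.subset_span ⟨1, one_mem A, rfl⟩)

theorem cyclicSubspace_mem_invtSubmodule (A : VonNeumannAlgebra H) (ξ : H) {a : H →L[ℂ] H}
    (ha : a ∈ A) : cyclicSubspace A ξ ∈ Module.End.invtSubmodule (a : H →ₗ[ℂ] H) := by
  have span_invariant : Submodule.span ℂ {η : H | ∃ x ∈ A, η = x ξ} ∈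
      Module.End.invtSubmodule (a : H →ₗ[ℂ] H) := by
    refine Submodule.span_le.2 ?_
    rintro _ ⟨x, hx, rfl⟩
    exact Submodule.subset_span ⟨a * x, mul_mem ha hx, rfl⟩
  exact Set.MapsTo.closure span_invariant a.continuous

theorem isStarProjection_cyclicProjection (A : VonNeumannAlgebra H) (ξ : H) :
    IsStarProjection (cyclicProjection A ξ) :=
  isStarProjection_starProjection

theorem cyclicProjection_mem_commutant (A : VonNeumannAlgebra H) (ξ : H) :
    cyclicProjection A ξ ∈ A.commutant := by
  rw [VonNeumannAlgebra.IsStarProjection.mem_iff (isStarProjection_cyclicProjection A ξ),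
    VonNeumannAlgebra.commutant_commutant]
  intro a ha
  have range_eq : (cyclicProjection A ξ).range = cyclicSubspace A ξ :=
    Submodule.range_starProjection _
  rw [range_eq]
  exact cyclicSubspace_mem_invtSubmodule A ξ ha

theorem cyclicProjection_commutant_mem (A : VonNeumannAlgebra H) (ξ : H) :
    cyclicProjection A.commutant ξ ∈ A := by
  simpa only [VonNeumannAlgebra.commutant_commutant] using
    cyclicProjection_mem_commutant A.commutant ξ

theorem cyclicProjection_apply_self (A : VonNeumannAlgebra H) (ξ : H) :
    cyclicProjection A ξ ξ = ξ :=
  Submodule.starProjection_eq_self_iff.2 (mem_cyclicSubspace_self A ξ)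

theorem cyclicProjection_ne_zero (A : VonNeumannAlgebra H) {ξ : H} (hξ : ξ ≠ 0) :
    cyclicProjection A ξ ≠ 0 := by
  intro h
  exact hξ (by rw [← cyclicProjection_apply_self A ξ, h, zero_apply])

open scoped ComplexOrder

theorem IsFaithfulNormalTrace.nonneg {A : VonNeumannAlgebra H} {τ : (H →L[ℂ] H) → ℂ}
    (hτ : IsFaithfulNormalTrace A τ) {x : H →L[ℂ] H} (hx : x ∈ A) (hpos : x.IsPositive) :
    0 ≤ τ x := by
  obtain ⟨ξ, -, hasSum⟩ := hτ.normal
  exact (hasSum x hx).nonneg fun n => hpos.inner_nonneg_right (ξ n)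

theorem IsFaithfulNormalTrace.star_mul_self_pos {A : VonNeumannAlgebra H}
    {τ : (H →L[ℂ] H) → ℂ} (hτ : IsFaithfulNormalTrace A τ) {x : H →L[ℂ] H} (hx : x ∈ A)
    (hne : x ≠ 0) : 0 < τ (star x * x) :=
  (hτ.nonneg (mul_mem (star_mem hx) hx) x.isPositive_adjoint_comp_self).lt_of_ne'
    fun h => hne (hτ.faithful x hx h)

theorem IsFaithfulNormalTrace.re_pos_of_isStarProjection {A : VonNeumannAlgebra H}
    {τ : (H →L[ℂ] H) → ℂ} (hτ : IsFaithfulNormalTrace A τ) {p : H →L[ℂ] H} (hp : p ∈ A)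
    (hproj : IsStarProjection p) (hne : p ≠ 0) : 0 < (τ p).re := by
  have star_mul_self : star p * p = p := by
    rw [hproj.isSelfAdjoint.star_eq, hproj.isIdempotentElem.eq]
  have pos := hτ.star_mul_self_pos hp hne
  rw [star_mul_self] at pos
  exact (Complex.pos_iff.1 pos).1

theorem HasTrace.isFaithfulNormalTrace_normalizedTrace {A : VonNeumannAlgebra H}
    (h : HasTrace A) : IsFaithfulNormalTrace A (normalizedTrace A) := by
  rw [normalizedTrace, dif_pos h]
  exact h.choose_spec

theorem couplingConstant_pos {A : VonNeumannAlgebra H} (hA : HasTrace A) {ξ : H} (hξ : ξ ≠ 0) :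
    0 < couplingConstant A ξ := by
  unfold couplingConstant
  split_ifs with hA'
  · refine ENNReal.ofReal_pos.2 (div_pos ?_ ?_)
    · exact hA.isFaithfulNormalTrace_normalizedTrace.re_pos_of_isStarProjection
        (cyclicProjection_commutant_mem A ξ) (isStarProjection_cyclicProjection _ ξ)
        (cyclicProjection_ne_zero _ hξ)
    · exact hA'.isFaithfulNormalTrace_normalizedTrace.re_pos_of_isStarProjection
        (cyclicProjection_mem_commutant A ξ) (isStarProjection_cyclicProjection A ξ)
        (cyclicProjection_ne_zero A hξ)
  · exact ENNReal.zero_lt_top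

theorem IsTraceVector.ne_zero {M : VonNeumannAlgebra H} {Ω : H} (hΩ : IsTraceVector M Ω) :
    Ω ≠ 0 :=
  norm_ne_zero_iff.1 (hΩ.norm_eq_one ▸ one_ne_zero)

end Index

theorem ceil_half_add_floor_half {K : Type*} [Field K] [LinearOrder K] [IsStrictOrderedRing K]
    [FloorRing K] (k : ℤ) : ⌈(k : K) / 2⌉ + ⌊(k : K) / 2⌋ = k := by
  have ceil_half : ⌈(k : K) / 2⌉ = k - ⌊(k : K) / 2⌋ :=
    calc ⌈(k : K) / 2⌉ = ⌈(k : K) + -((k : K) / 2)⌉ := by congr 1; ring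
      _ = k - ⌊(k : K) / 2⌋ := by rw [Int.ceil_intCast_add, Int.ceil_neg, sub_eq_add_neg]
  rw [ceil_half, sub_add_cancel]

namespace Tangle

variable {T T' S : Tangle} {i : Fin T.b}

theorem IsComposition.outer_colour_eq (hS : T.IsComposition i T' S) :
    S.outer.colour = T.outer.colour := by
  obtain ⟨_, _, _, -, -, -, -, mapsTo_outer, -⟩ := hS
  exact mapsTo_outer.colour_eq

theorem IsComposition.sum_inner_add {N : Type*} [AddCommMonoid N] (hS : T.IsComposition i T' S)
    (φ : Colour → N) :
    ∑ j, φ (S.inner j).colour + φ (T.inner i).colour =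
      ∑ j, φ (T.inner j).colour + ∑ j, φ (T'.inner j).colour := by
  obtain ⟨_, _, e, -, -, -, -, -, mapsTo_inl, mapsTo_inr, -⟩ := hS
  have sum_S : ∑ j, φ (S.inner j).colour =
      ∑ j : {j // j ≠ i}, φ (T.inner j).colour + ∑ j, φ (T'.inner j).colour := by
    rw [← e.sum_comp, Fintype.sum_sum_type]
    simp only [(mapsTo_inl _).colour_eq, (mapsTo_inr _).colour_eq]
  rw [sum_S, Fintype.sum_eq_add_sum_subtype_ne _ i]
  abel

theorem IsComposition.c_add_c_sub_c (hS : T.IsComposition i T' S)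
    (hsize : T'.outer.size = (T.inner i).size) :
    T.c + T'.c - S.c = T'.outer.size - T.loops - T'.loops + S.loops := by
  have outer_size : S.outer.size = T.outer.size := congrArg Colour.size hS.outer_colour_eq
  have inner_sum : ∑ j, ⌊((S.inner j).size : ℚ) / 2⌋ + ⌊(T'.outer.size : ℚ) / 2⌋ =
      ∑ j, ⌊((T.inner j).size : ℚ) / 2⌋ + ∑ j, ⌊((T'.inner j).size : ℚ) / 2⌋ := by
    rw [hsize]
    exact hS.sum_inner_add fun k => ⌊(k.size : ℚ) / 2⌋
  have halves : ⌈(T'.outer.size : ℚ) / 2⌉ + ⌊(T'.outer.size : ℚ) / 2⌋ = T'.outer.size :=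
    ceil_half_add_floor_half (K := ℚ) T'.outer.size
  unfold c
  rw [outer_size]
  linarith

end Tangle

end IntermediatePlanar

theorem proposition3p1_general {H : Type*} [NormedAddCommGroup H] [InnerProductSpace ℂ H]
    [CompleteSpace H] {Q : VonNeumannAlgebra H} {ξ : H} (hQ : IntermediatePlanar.HasTrace Q)
    (hξ : ξ ≠ 0) (hfin : IntermediatePlanar.jonesIndex Q ξ ≠ ⊤)
    {T T' S : IntermediatePlanar.Tangle} {i : Fin T.b}
    (hsize : T'.outer.size = (T.inner i).size) (hS : T.IsComposition i T' S) :
    T.alpha Q ξ * T'.alpha Q ξ / S.alpha Q ξ =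
      (IntermediatePlanar.jonesIndex Q ξ).toReal ^
        ((1 / 2 : ℝ) * ((T'.outer.size : ℝ) - T.loops - T'.loops + S.loops)) := by
  have index_pos : 0 < (IntermediatePlanar.jonesIndex Q ξ).toReal :=
    ENNReal.toReal_pos (IntermediatePlanar.couplingConstant_pos hQ hξ).ne' hfin
  have exponent : (T.c : ℝ) + T'.c - S.c = T'.outer.size - T.loops - T'.loops + S.loops :=
    mod_cast hS.c_add_c_sub_c hsize
  unfold IntermediatePlanar.Tangle.alpha
  rw [← Real.rpow_add index_pos, ← Real.rpow_sub index_pos, ← exponent, mul_sub, mul_add]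

theorem proposition3p1 {H : Type*} [NormedAddCommGroup H] [InnerProductSpace ℂ H]
    [CompleteSpace H] (M Q : VonNeumannAlgebra H) (Ω : H)
    (hM : IntermediatePlanar.IsTypeIIOneFactor M)
    (hΩ : IntermediatePlanar.IsTraceVector M Ω)
    (hQ : IntermediatePlanar.IsTypeIIOneFactor Q) (hQM : Q ≤ M)
    (hfin : IntermediatePlanar.jonesIndex Q Ω ≠ ⊤)
    (T T' S : IntermediatePlanar.Tangle) (i : Fin T.b)
    (hcolour : T'.outer.colour = (T.inner i).colour)
    (hS : T.IsComposition i T' S) :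
    T.alpha Q Ω * T'.alpha Q Ω / S.alpha Q Ω =
      (IntermediatePlanar.jonesIndex Q Ω).toReal ^
        ((1 / 2 : ℝ) * ((T'.outer.size : ℝ) - T.loops - T'.loops + S.loops)) :=
  proposition3p1_general hQ.hasTrace hΩ.ne_zero hfin
    (congrArg IntermediatePlanar.Colour.size hcolour) hS
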